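/- Let $x_1,\dots,x_n\in\mathbb R^p$ and $y_1,\dots,y_n\in\mathbb R$ be regression data. Assume that the data are nondegenerate, in the following sense: any $p$ of the vectors $x_1,\dots,x_n$ are linearly independent, and for every $\theta\in\mathbb R^p$ and every real $\rho$ at most $p+1$ indices $i$ satisfy $|y_i-x_i^\top\theta|=\rho$. For each integer $k$ with $0\le k\le n-(p+1)$ let $$f_k(\theta)=\min_{I\subset\{1,\dots,n\},\ |I|=n-k}\ \max_{i\in I}\,|y_i-x_i^\top\theta| ,\qquad \theta\in\mathbb R^p,$$ which is the $(n-k)$-th smallest of the absolute residuals $|y_i-x_i^\top\theta|$, $i=1,\dots,n$ (counted with repetition). Then $f_k$ has exactly $\binom{p+k}{p}$ local minima, that is, exactly $\binom{p+k}{p}$ points $\theta\in\mathbb R^p$ are local minimum points of $f_k$. In particular, let $n\ge 1$ and $n/2\ge p$, and let the median of $n$ numbers be their $(\lfloor n/2\rfloor+1)$-th smallest (the case $k=\lfloor (n-1)/2\rfloor$). Then the least-median-of-squares objective $\theta\mapsto\operatorname{med}_i\,(y_i-x_i^\top\theta)^2$, and likewise $\theta\mapsto\operatorname{med}_i\,|y_i-x_i^\top\theta|$,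 has exactly $\binom{p+\lfloor (n-1)/2\rfloor}{p}$ local minima. -/

import Mathlib

open scoped Matrix

namespace LMS

noncomputable section

/-- The residual `y_i - x_iᵀ θ`, where `x_i` is the `i`-th row of `X`. -/
def residual {n p : ℕ} (X : Matrix (Fin n) (Fin p) ℝ) (y : Fin n → ℝ)
    (θ : Fin p → ℝ) (i : Fin n) : ℝ :=
  y i - X i ⬝ᵥ θ

/-- The largest absolute residual over the indices in `I` (a maximum over a finite set; it is only
used for nonempty `I`). -/
def maxAbsResidual {n p : ℕ} (X : Matrix (Fin n) (Fin p) ℝ) (y : Fin n → ℝ)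
    (I : Finset (Fin n)) (θ : Fin p → ℝ) : ℝ :=
  ⨆ i : I, |residual X y θ i|

/-- The function `f_k`: the minimum over all `(n - k)`-subsets `I` of the indices of the largest
absolute residual over `I` (a minimum over a finite family, nonempty for `k ≤ n`). -/
def trimmedMax {n p : ℕ} (X : Matrix (Fin n) (Fin p) ℝ) (y : Fin n → ℝ)
    (k : ℕ) (θ : Fin p → ℝ) : ℝ :=
  ⨅ I : {I : Finset (Fin n) // I.card = n - k}, maxAbsResidual X y I.1 θ

/-- The entries of `r` in increasing order, with repetitions. Indices start at `0`, so that
`sorted r j` is the `(j + 1)`-th smallest entry. -/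
def sorted {n : ℕ} (r : Fin n → ℝ) : Fin n → ℝ :=
  r ∘ Tuple.sort r

/-- The median, taken to be the `(⌊n / 2⌋ + 1)`-th smallest entry. -/
def med {n : ℕ} (hn : 0 < n) (r : Fin n → ℝ) : ℝ :=
  sorted r ⟨n / 2, Nat.div_lt_self hn one_lt_two⟩

/-- Nondegenerate regression data: any `p` of the vectors `x_i` are linearly independent, and at
no parameter `θ` do more than `p + 1` absolute residuals have the same value. -/
structure Nondegenerate {n p : ℕ} (X : Matrix (Fin n) (Fin p) ℝ) (y : Fin n → ℝ) : Prop where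
  linearIndependent : ∀ I : Finset (Fin n), I.card = p →
    LinearIndependent ℝ (fun i : I => (X i : Fin p → ℝ))
  card_tie_le : ∀ (θ : Fin p → ℝ) (ρ : ℝ), {i : Fin n | |residual X y θ i| = ρ}.ncard ≤ p + 1

/-- The set of (not necessarily strict) local minimum points of `f`. -/
def localMinima {p : ℕ} (f : (Fin p → ℝ) → ℝ) : Set (Fin p → ℝ) :=
  {θ | IsLocalMin f θ}

end

end LMS

/-!
The argument treats Chebyshev fitting as an LP-type problem, in the manner of Clarkson's count of
the local minima of a level of an arrangement.

For an index set `I` with at least `p + 1` elements, the largest absolute residual over `I` is a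
convex, coercive function of the parameter. It has a unique minimizer `fit X y I`, and at this
minimizer exactly `p + 1` residuals over `I` are tight: fewer could be shrunk simultaneously,
because `p` of the row vectors are independent (`Nondegenerate.card_tight`), and more are excluded
by nondegeneracy. The tight indices form the base of `I`, which determines the fit. A
`(p + 1)`-set `B` is the base of `I` exactly when `B ⊆ I` and `I` avoids the violators of `B`, the
indices whose residual at `fit X y B` is too large (`Nondegenerate.base_eq_iff`).

Counting the `m`-sets of indices by their bases gives, for each `m` between `p + 1` and `n`, a
linear equation for the numbers of bases with `k` violators. This system is triangular and is
solved by `k ↦ (p + k).choose p`, thanks to a Vandermonde-type identity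
(`Nondegenerate.card_bases`).

Finally, `fit X y` is a bijection from the bases with `k` violators onto the local minimum points
of the trimmed maximum. Near the fit to such a base, the only index set of size `n - k` that
avoids all violators is their complement, so the trimmed maximum is bounded below by the optimal
value of the base (`Nondegenerate.eventually_le_trimmedMax`). Conversely, every index set
attaining the trimmed maximum at a local minimum `θ` has `θ` as its fit, by convexity
(`Nondegenerate.exists_fit_eq_of_isLocalMin`).
-/

namespace LMS

/-! ### Binomial identities -/

theorem sum_choose_mul_choose (p q j : ℕ) :
    ∑ a ∈ Finset.range (q + 1), (p + a).choose p * (q - a).choose j =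
      (p + q + 1).choose (p + j + 1) := by
  induction q generalizing j with
  | zero =>
    cases j with
    | zero => simp
    | succ j => simp [Nat.choose_eq_zero_of_lt]
  | succ q ih =>
    cases j with
    | zero =>
      have h := Nat.sum_range_add_choose (q + 1) p
      simpa [add_comm, add_left_comm, add_assoc] using h
    | succ j =>
      rw [Finset.sum_range_succ, Nat.sub_self, Nat.choose_zero_succ, mul_zero, add_zero]
      have h : ∀ a ∈ Finset.range (q + 1), (p + a).choose p * (q + 1 - a).choose (j + 1) =
          (p + a).choose p * (q - a).choose j + (p + a).choose p * (q - a).choose (j + 1) := by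
        intro a ha
        rw [Finset.mem_range] at ha
        rw [show q + 1 - a = (q - a) + 1 by omega, Nat.choose_succ_succ, mul_add]
      rw [Finset.sum_congr rfl h, Finset.sum_add_distrib, ih, ih]
      exact (Nat.choose_succ_succ (p + q + 1) (p + j + 1)).symm

/-- The binomial sums `∑ a, u a * (q - a).choose j`, for `j ≤ q`, determine `u`: the system is
triangular with ones on the diagonal. -/
theorem eq_of_sum_mul_choose_eq {q : ℕ} {u v : ℕ → ℕ}
    (h : ∀ j ≤ q, ∑ a ∈ Finset.range (q + 1), u a * (q - a).choose j =
      ∑ a ∈ Finset.range (q + 1), v a * (q - a).choose j) :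
    ∀ k ≤ q, u k = v k := by
  intro k
  induction k using Nat.strong_induction_on with
  | _ k ih =>
    intro hk
    have key : ∀ w : ℕ → ℕ, ∑ a ∈ Finset.range (q + 1), w a * (q - a).choose (q - k) =
        ∑ a ∈ Finset.range k, w a * (q - a).choose (q - k) + w k := by
      intro w
      have hsub : Finset.range (k + 1) ⊆ Finset.range (q + 1) :=
        Finset.range_subset_range.2 (by omega)
      rw [← Finset.sum_subset hsub, Finset.sum_range_succ, Nat.choose_self, mul_one]
      intro a ha hak
      rw [Finset.mem_range] at ha hak
      rw [Nat.choose_eq_zero_of_lt (by omega), mul_zero]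
    have hj := h (q - k) (Nat.sub_le q k)
    rw [key, key, Finset.sum_congr rfl fun a ha => by
      rw [ih a (Finset.mem_range.1 ha) ((Finset.mem_range.1 ha).le.trans hk)]] at hj
    exact Nat.add_left_cancel hj

/-! ### The largest absolute residual over a set of indices -/

variable {n p : ℕ} {X : Matrix (Fin n) (Fin p) ℝ} {y : Fin n → ℝ} {I B : Finset (Fin n)}
  {θ : Fin p → ℝ}

theorem continuous_residual (i : Fin n) : Continuous fun θ => residual X y θ i := by
  unfold residual dotProduct
  fun_prop

theorem maxAbsResidual_nonneg : 0 ≤ maxAbsResidual X y I θ :=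
  Real.iSup_nonneg fun _ => abs_nonneg _

theorem abs_residual_le_maxAbsResidual {i : Fin n} (hi : i ∈ I) :
    |residual X y θ i| ≤ maxAbsResidual X y I θ :=
  le_ciSup (f := fun i : I => |residual X y θ i|) (Set.finite_range _).bddAbove ⟨i, hi⟩

theorem maxAbsResidual_le {c : ℝ} (hc : 0 ≤ c) (h : ∀ i ∈ I, |residual X y θ i| ≤ c) :
    maxAbsResidual X y I θ ≤ c :=
  Real.iSup_le (fun i => h i i.2) hc

theorem maxAbsResidual_mono (h : B ⊆ I) : maxAbsResidual X y B θ ≤ maxAbsResidual X y I θ :=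
  maxAbsResidual_le maxAbsResidual_nonneg fun _ hi => abs_residual_le_maxAbsResidual (h hi)

theorem exists_maxAbsResidual_eq (hI : I.Nonempty) :
    ∃ i ∈ I, maxAbsResidual X y I θ = |residual X y θ i| := by
  have : Nonempty I := hI.to_subtype
  obtain ⟨j, hj⟩ := exists_eq_ciSup_of_finite (f := fun i : I => |residual X y θ i|)
  exact ⟨j, j.2, hj.symm⟩

/-- The largest absolute residual over `I` is the sup norm of the vector of residuals over `I`. -/
theorem maxAbsResidual_eq_norm :
    maxAbsResidual X y I θ =
      ‖(fun i : I => y i) - (X.submatrix (Subtype.val : I → Fin n) id).mulVecLin θ‖ := by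
  apply le_antisymm
  · exact maxAbsResidual_le (norm_nonneg _) fun i hi =>
      norm_le_pi_norm ((fun i : I => y i) -
        (X.submatrix (Subtype.val : I → Fin n) id).mulVecLin θ) ⟨i, hi⟩
  · exact (pi_norm_le_iff_of_nonneg maxAbsResidual_nonneg).2 fun i =>
      abs_residual_le_maxAbsResidual i.2

theorem convexOn_maxAbsResidual : ConvexOn ℝ Set.univ (maxAbsResidual X y I) := by
  refine ⟨convex_univ, fun θ _ φ _ a b ha hb hab => ?_⟩
  refine maxAbsResidual_le (add_nonneg (smul_nonneg ha maxAbsResidual_nonneg)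
    (smul_nonneg hb maxAbsResidual_nonneg)) fun i hi => ?_
  have h : residual X y (a • θ + b • φ) i = a * residual X y θ i + b * residual X y φ i := by
    simp only [residual, dotProduct_add, dotProduct_smul, smul_eq_mul]
    linear_combination (-y i) * hab
  rw [h]
  refine (abs_add_le _ _).trans ?_
  rw [abs_mul, abs_mul, abs_of_nonneg ha, abs_of_nonneg hb]
  exact add_le_add (mul_le_mul_of_nonneg_left (abs_residual_le_maxAbsResidual hi) ha)
    (mul_le_mul_of_nonneg_left (abs_residual_le_maxAbsResidual hi) hb)

/-! ### Chebyshev fits -/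

/-- `θ` is a Chebyshev fit to the data indexed by `I`: it minimizes the largest absolute
residual over `I`. -/
def IsFit (X : Matrix (Fin n) (Fin p) ℝ) (y : Fin n → ℝ) (I : Finset (Fin n))
    (θ : Fin p → ℝ) : Prop :=
  ∀ φ, maxAbsResidual X y I θ ≤ maxAbsResidual X y I φ

theorem IsFit.of_isLocalMin (h : IsLocalMin (maxAbsResidual X y I) θ) : IsFit X y I θ :=
  IsMinOn.of_isLocalMin_of_convex_univ h convexOn_maxAbsResidual

/-- The linear map of any square subsystem is bijective. -/
theorem Nondegenerate.bijective_mulVecLin (h : Nondegenerate X y) (hB : B.card = p) :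
    Function.Bijective (X.submatrix (Subtype.val : B → Fin n) id).mulVecLin := by
  have hcard : Fintype.card B = p := by simpa using hB
  have hli : LinearIndependent ℝ (X.submatrix (Subtype.val : B → Fin n) id).row :=
    h.linearIndependent B hB
  have hsurj : Function.Surjective (X.submatrix (Subtype.val : B → Fin n) id).mulVecLin := by
    rw [← LinearMap.range_eq_top]
    apply Submodule.eq_top_of_finrank_eq
    rw [Module.finrank_fintype_fun_eq_card]
    exact hli.rank_matrix
  exact ⟨(LinearMap.injective_iff_surjective_of_finrank_eq_finrank (by simp [hcard])).2 hsurj,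
    hsurj⟩

theorem Nondegenerate.eq_of_forall_dotProduct_eq (h : Nondegenerate X y) (hI : p ≤ I.card)
    {φ : Fin p → ℝ} (heq : ∀ i ∈ I, X i ⬝ᵥ θ = X i ⬝ᵥ φ) : θ = φ := by
  obtain ⟨B, hBI, hB⟩ := Finset.exists_subset_card_eq hI
  exact (h.bijective_mulVecLin hB).1 (funext fun i => heq i (hBI i.2))

theorem Nondegenerate.exists_dotProduct_eq (h : Nondegenerate X y) (hn : p ≤ n)
    (hI : I.card ≤ p) (c : Fin n → ℝ) : ∃ d : Fin p → ℝ, ∀ i ∈ I, X i ⬝ᵥ d = c i := by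
  obtain ⟨B, hIB, -, hB⟩ := Finset.exists_subsuperset_card_eq I.subset_univ hI (by simpa using hn)
  obtain ⟨d, hd⟩ := (h.bijective_mulVecLin hB).2 fun i => c i
  exact ⟨d, fun i hi => congrFun hd ⟨i, hIB hi⟩⟩

/-- Chebyshev fits exist: the largest absolute residual is continuous and, the linear map being
injective, coercive. -/
theorem Nondegenerate.exists_isFit (h : Nondegenerate X y) (hI : p + 1 ≤ I.card) :
    ∃ θ, IsFit X y I θ := by
  set L := (X.submatrix (Subtype.val : I → Fin n) id).mulVecLin with hL
  have hinj : Function.Injective L := fun θ φ hθφ =>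
    h.eq_of_forall_dotProduct_eq (I := I) (by omega) fun i hi => congrFun hθφ ⟨i, hi⟩
  have hemb := LinearMap.isClosedEmbedding_of_injective (LinearMap.ker_eq_bot.2 hinj)
  have hlim : Filter.Tendsto (maxAbsResidual X y I) (Filter.cocompact _) Filter.atTop := by
    have h1 : Filter.Tendsto (fun θ => ‖L θ‖ - ‖fun i : I => y i‖)
        (Filter.cocompact _) Filter.atTop :=
      Filter.tendsto_atTop_add_const_right _ _
        (tendsto_norm_cocompact_atTop.comp hemb.tendsto_cocompact)
    refine Filter.tendsto_atTop_mono (fun θ => ?_) h1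
    rw [maxAbsResidual_eq_norm, norm_sub_rev]
    exact norm_sub_norm_le _ _
  have hcont : Continuous (maxAbsResidual X y I) := by
    have : maxAbsResidual X y I = fun θ => ‖(fun i : I => y i) - L θ‖ :=
      funext fun θ => maxAbsResidual_eq_norm
    rw [this]
    exact (continuous_const.sub hemb.continuous).norm
  exact hcont.exists_forall_le hlim

/-- The indices in `I` at which the absolute residual at `θ` is largest. -/
noncomputable def tight (X : Matrix (Fin n) (Fin p) ℝ) (y : Fin n → ℝ) (I : Finset (Fin n))
    (θ : Fin p → ℝ) : Finset (Fin n) :=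
  {i ∈ I | |residual X y θ i| = maxAbsResidual X y I θ}

theorem mem_tight {i : Fin n} :
    i ∈ tight X y I θ ↔ i ∈ I ∧ |residual X y θ i| = maxAbsResidual X y I θ := by
  simp [tight]

theorem tight_subset : tight X y I θ ⊆ I := Finset.filter_subset _ _

theorem Nondegenerate.card_le_of_forall_eq (h : Nondegenerate X y) {ρ : ℝ}
    (hI : ∀ i ∈ I, |residual X y θ i| = ρ) : I.card ≤ p + 1 := by
  refine le_trans ?_ (h.card_tie_le θ ρ)
  rw [← Set.ncard_coe_finset]
  exact Set.ncard_le_ncard hI (Set.toFinite _)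

/-- Off the tight indices the absolute residuals stay below the maximum near `θ`. -/
theorem eventually_abs_residual_lt :
    ∀ᶠ φ in nhds θ, ∀ i ∈ I, i ∉ tight X y I θ →
      |residual X y φ i| < maxAbsResidual X y I θ := by
  rw [Filter.eventually_all_finset]
  intro i hi
  by_cases hit : i ∈ tight X y I θ
  · exact Filter.Eventually.of_forall fun φ hit' => absurd hit hit'
  · have hlt : |residual X y θ i| < maxAbsResidual X y I θ :=
      lt_of_le_of_ne (abs_residual_le_maxAbsResidual hi) fun he => hit (mem_tight.2 ⟨hi, he⟩)
    filter_upwards [(continuous_residual (X := X) (y := y) i).abs.continuousAt.eventually_lt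
      continuousAt_const hlt] with φ hφ _ using hφ

/-- With at most `p` tight indices, the residuals at those indices could be shrunk
simultaneously, so that a Chebyshev fit has exactly `p + 1` of them. -/
theorem Nondegenerate.card_tight (h : Nondegenerate X y) (hI : p + 1 ≤ I.card)
    (hθ : IsFit X y I θ) : (tight X y I θ).card = p + 1 := by
  refine le_antisymm (h.card_le_of_forall_eq fun i hi => (mem_tight.1 hi).2) ?_
  by_contra! hlt
  have hn : I.card ≤ n := by simpa using I.card_le_univ
  -- If the maximum is `0`, nothing can shrink, but then every index in `I` is tight.
  rcases maxAbsResidual_nonneg (X := X) (y := y) (I := I) (θ := θ) |>.eq_or_lt with h0 | hpos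
  · have : tight X y I θ = I := Finset.filter_true_of_mem fun i hi =>
      le_antisymm (abs_residual_le_maxAbsResidual hi) (h0 ▸ abs_nonneg _)
    rw [this] at hlt
    omega
  -- Moving from `θ` by `t • d` multiplies each tight residual by `1 - t`.
  obtain ⟨d, hd⟩ := h.exists_dotProduct_eq (I := tight X y I θ) (by omega) (by omega)
    (residual X y θ)
  have hline : Filter.Tendsto (fun t : ℝ => θ + t • d) (nhdsWithin 0 (Set.Ioi 0)) (nhds θ) := by
    have : Continuous fun t : ℝ => θ + t • d := by fun_prop
    simpa using (this.tendsto 0).mono_left nhdsWithin_le_nhds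
  obtain ⟨t, ht, ht0, ht1⟩ := ((hline.eventually (eventually_abs_residual_lt (X := X) (y := y)
    (I := I))).and (Ioo_mem_nhdsGT (zero_lt_one' ℝ))).exists
  have hsmall : ∀ i ∈ I, |residual X y (θ + t • d) i| < maxAbsResidual X y I θ := by
    intro i hi
    by_cases hit : i ∈ tight X y I θ
    · have : residual X y (θ + t • d) i = (1 - t) * residual X y θ i := by
        have := hd i hit
        simp only [residual, dotProduct_add, dotProduct_smul, smul_eq_mul] at this ⊢
        rw [this]
        ring
      rw [this, abs_mul, (mem_tight.1 hit).2, abs_of_pos (by linarith)]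
      nlinarith
    · exact ht i hi hit
  obtain ⟨j, hjI, hj⟩ := exists_maxAbsResidual_eq (X := X) (y := y) (θ := θ + t • d)
    (Finset.card_pos.1 (by omega : 0 < I.card))
  exact absurd (hθ (θ + t • d)) (not_le.2 (hj.trans_lt (hsmall j hjI)))

/-- At the midpoint of two Chebyshev fits the tight residuals agree with those at both fits, and
there are enough of them to determine the parameter. -/
theorem Nondegenerate.isFit_unique (h : Nondegenerate X y) (hI : p + 1 ≤ I.card)
    {φ : Fin p → ℝ} (hθ : IsFit X y I θ) (hφ : IsFit X y I φ) : θ = φ := by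
  have hval : maxAbsResidual X y I θ = maxAbsResidual X y I φ := le_antisymm (hθ φ) (hφ θ)
  set ψ := (1 / 2 : ℝ) • θ + (1 / 2 : ℝ) • φ with hψ
  have hle : maxAbsResidual X y I ψ ≤ maxAbsResidual X y I θ := by
    have := (convexOn_maxAbsResidual (X := X) (y := y) (I := I)).2 (Set.mem_univ θ)
      (Set.mem_univ φ) (by norm_num : (0 : ℝ) ≤ 1 / 2) (by norm_num : (0 : ℝ) ≤ 1 / 2)
      (by norm_num)
    rw [← hval, ← add_smul] at this
    norm_num at this
    simpa [hψ] using this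
  have hfit : IsFit X y I ψ := fun χ => hle.trans (hθ χ)
  have hψθ : maxAbsResidual X y I ψ = maxAbsResidual X y I θ := le_antisymm hle (hθ ψ)
  refine h.eq_of_forall_dotProduct_eq (I := tight X y I ψ) (by rw [h.card_tight hI hfit]; omega)
    fun i hi => ?_
  obtain ⟨hiI, hi⟩ := mem_tight.1 hi
  have h1 : |residual X y θ i| ≤ maxAbsResidual X y I θ := abs_residual_le_maxAbsResidual hiI
  have h2 : |residual X y φ i| ≤ maxAbsResidual X y I θ :=
    hval ▸ abs_residual_le_maxAbsResidual hiI
  have h3 : residual X y ψ i = (residual X y θ i + residual X y φ i) / 2 := by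
    simp only [hψ, residual, dotProduct_add, dotProduct_smul, smul_eq_mul]
    ring
  rw [hψθ] at hi
  suffices residual X y θ i = residual X y φ i by simpa [residual] using this
  rw [abs_le] at h1 h2
  rcases abs_cases (residual X y ψ i) with ⟨he, -⟩ | ⟨he, -⟩ <;> linarith

/-- A Chebyshev fit is already determined by its tight indices. -/
theorem IsFit.isFit_tight (hθ : IsFit X y I θ) (hne : (tight X y I θ).Nonempty) :
    IsFit X y (tight X y I θ) θ ∧
      maxAbsResidual X y (tight X y I θ) θ = maxAbsResidual X y I θ := by
  have hval : maxAbsResidual X y (tight X y I θ) θ = maxAbsResidual X y I θ := by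
    obtain ⟨i, hi⟩ := hne
    exact le_antisymm (maxAbsResidual_mono tight_subset)
      ((mem_tight.1 hi).2 ▸ abs_residual_le_maxAbsResidual hi)
  refine ⟨IsFit.of_isLocalMin ?_, hval⟩
  filter_upwards [eventually_abs_residual_lt (X := X) (y := y) (I := I) (θ := θ)] with φ hφ
  rw [hval]
  by_contra! hlt
  obtain ⟨j, hjI, hj⟩ := exists_maxAbsResidual_eq (X := X) (y := y) (θ := φ)
    (hne.mono tight_subset)
  refine absurd (hθ φ) (not_le.2 (hj.trans_lt ?_))
  by_cases hjt : j ∈ tight X y I θ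
  · exact (abs_residual_le_maxAbsResidual hjt).trans_lt hlt
  · exact hφ j hjI hjt

/-! ### Bases and their violators -/

/-- The Chebyshev fit to the data indexed by `I`. It is a junk value when no fit exists, and an
arbitrary fit when there are several; for nondegenerate data and `p + 1 ≤ I.card` there is
exactly one. -/
noncomputable def fit (X : Matrix (Fin n) (Fin p) ℝ) (y : Fin n → ℝ) (I : Finset (Fin n)) :
    Fin p → ℝ :=
  Classical.epsilon (IsFit X y I)

/-- The base of `I`: the indices in `I` at which the Chebyshev fit to `I` attains its largest
absolute residual. -/
noncomputable def base (X : Matrix (Fin n) (Fin p) ℝ) (y : Fin n → ℝ) (I : Finset (Fin n)) :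
    Finset (Fin n) :=
  tight X y I (fit X y I)

/-- The violators of `B`: the indices at which the absolute residual of the Chebyshev fit to `B`
exceeds all those over `B`. -/
noncomputable def violators (X : Matrix (Fin n) (Fin p) ℝ) (y : Fin n → ℝ)
    (B : Finset (Fin n)) : Finset (Fin n) :=
  {i | maxAbsResidual X y B (fit X y B) < |residual X y (fit X y B) i|}

theorem mem_violators {i : Fin n} :
    i ∈ violators X y B ↔ maxAbsResidual X y B (fit X y B) < |residual X y (fit X y B) i| := by
  simp [violators]

theorem disjoint_violators : Disjoint B (violators X y B) :=
  Finset.disjoint_left.2 fun _ hi hv =>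
    absurd (mem_violators.1 hv) (abs_residual_le_maxAbsResidual hi).not_gt

theorem Nondegenerate.isFit_fit (h : Nondegenerate X y) (hI : p + 1 ≤ I.card) :
    IsFit X y I (fit X y I) :=
  Classical.epsilon_spec (h.exists_isFit hI)

theorem Nondegenerate.eq_fit (h : Nondegenerate X y) (hI : p + 1 ≤ I.card)
    (hθ : IsFit X y I θ) : θ = fit X y I :=
  h.isFit_unique hI hθ (h.isFit_fit hI)

theorem Nondegenerate.card_base (h : Nondegenerate X y) (hI : p + 1 ≤ I.card) :
    (base X y I).card = p + 1 :=
  h.card_tight hI (h.isFit_fit hI)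

theorem Nondegenerate.base_eq_self (h : Nondegenerate X y) (hB : B.card = p + 1) :
    base X y B = B :=
  Finset.eq_of_subset_of_card_le tight_subset (by rw [h.card_base hB.ge, hB])

theorem Nondegenerate.abs_residual_fit_eq_iff (h : Nondegenerate X y) (hB : B.card = p + 1)
    {i : Fin n} :
    |residual X y (fit X y B) i| = maxAbsResidual X y B (fit X y B) ↔ i ∈ B := by
  have hmem : ∀ j ∈ B, |residual X y (fit X y B) j| = maxAbsResidual X y B (fit X y B) :=
    fun j hj => by
      rw [← h.base_eq_self hB] at hj
      exact (mem_tight.1 hj).2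
  refine ⟨fun hi => ?_, hmem i⟩
  by_contra hiB
  have := h.card_le_of_forall_eq (I := insert i B)
    (Finset.forall_mem_insert _ _ _ |>.2 ⟨hi, hmem⟩)
  rw [Finset.card_insert_of_notMem hiB] at this
  omega

theorem Nondegenerate.fit_base (h : Nondegenerate X y) (hI : p + 1 ≤ I.card) :
    fit X y (base X y I) = fit X y I ∧
      maxAbsResidual X y (base X y I) (fit X y I) = maxAbsResidual X y I (fit X y I) := by
  have hcard := h.card_base hI
  have := (h.isFit_fit hI).isFit_tight (Finset.card_pos.1 (by
    change 0 < (base X y I).card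
    omega))
  exact ⟨(h.eq_fit hcard.ge this.1).symm, this.2⟩

theorem Nondegenerate.fit_eq_of_subset (h : Nondegenerate X y) (hB : B.card = p + 1)
    (hBI : B ⊆ I) (hd : Disjoint I (violators X y B)) :
    fit X y I = fit X y B ∧
      maxAbsResidual X y I (fit X y B) = maxAbsResidual X y B (fit X y B) := by
  have hle : maxAbsResidual X y I (fit X y B) ≤ maxAbsResidual X y B (fit X y B) :=
    maxAbsResidual_le maxAbsResidual_nonneg fun i hi =>
      not_lt.1 fun hlt => Finset.disjoint_left.1 hd hi (mem_violators.2 hlt)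
  have hfit : IsFit X y I (fit X y B) := fun φ =>
    hle.trans ((h.isFit_fit hB.ge φ).trans (maxAbsResidual_mono hBI))
  exact ⟨(h.eq_fit (hB.ge.trans (Finset.card_le_card hBI)) hfit).symm,
    le_antisymm hle (maxAbsResidual_mono hBI)⟩

/-- The index sets with base `B` are those between `B` and the complement of its violators. -/
theorem Nondegenerate.base_eq_iff (h : Nondegenerate X y) (hI : p + 1 ≤ I.card)
    (hB : B.card = p + 1) : base X y I = B ↔ B ⊆ I ∧ Disjoint I (violators X y B) := by
  constructor
  · rintro rfl
    refine ⟨tight_subset, Finset.disjoint_left.2 fun i hi hv => ?_⟩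
    rw [mem_violators, (h.fit_base hI).1, (h.fit_base hI).2] at hv
    exact absurd hv (abs_residual_le_maxAbsResidual hi).not_gt
  · rintro ⟨hBI, hd⟩
    obtain ⟨h1, h2⟩ := h.fit_eq_of_subset hB hBI hd
    refine (Finset.eq_of_subset_of_card_le (fun i hi => mem_tight.2 ⟨hBI hi, ?_⟩) ?_).symm
    · rw [h1, h2]
      exact (h.abs_residual_fit_eq_iff hB).2 hi
    · exact (h.card_base hI).trans hB.symm |>.le

theorem card_violators_add_le (hB : B.card = p + 1) :
    (violators X y B).card + (p + 1) ≤ n := by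
  rw [← hB, add_comm, ← Finset.card_union_of_disjoint disjoint_violators]
  simpa using (B ∪ violators X y B).card_le_univ

/-! ### Counting bases by their number of violators -/

theorem card_filter_subset_disjoint {α : Type*} [Fintype α] [DecidableEq α] {B V : Finset α}
    (hBV : Disjoint B V) {m : ℕ} (hm : B.card ≤ m) :
    ((Finset.univ.powersetCard m).filter fun I => B ⊆ I ∧ Disjoint I V).card =
      (Fintype.card α - B.card - V.card).choose (m - B.card) := by
  have hcard : ((B ∪ V)ᶜ).card = Fintype.card α - B.card - V.card := by
    rw [Finset.card_compl, Finset.card_union_of_disjoint hBV, Nat.sub_sub]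
  rw [← hcard, ← Finset.card_powersetCard]
  refine Finset.card_nbij' (fun I => I \ B) (fun J => J ∪ B) ?_ ?_ ?_ ?_
  · intro I hI
    simp only [Finset.coe_filter, Finset.mem_powersetCard, Set.mem_ofPred_eq] at hI
    obtain ⟨⟨-, hIm⟩, hBI, hd⟩ := hI
    rw [Finset.mem_coe, Finset.mem_powersetCard, Finset.card_sdiff_of_subset hBI, hIm]
    refine ⟨fun i hi => ?_, rfl⟩
    rw [Finset.mem_sdiff] at hi
    simpa [hi.2] using Finset.disjoint_left.1 hd hi.1
  · intro J hJ
    rw [Finset.mem_coe, Finset.mem_powersetCard] at hJ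
    obtain ⟨hJ, hJm⟩ := hJ
    have hd : Disjoint J (B ∪ V) := Finset.disjoint_left.2 fun i hi => Finset.mem_compl.1 (hJ hi)
    rw [Finset.disjoint_union_right] at hd
    simp only [Finset.coe_filter, Finset.mem_powersetCard, Set.mem_ofPred_eq]
    refine ⟨⟨Finset.subset_univ _, ?_⟩, Finset.subset_union_right,
      Finset.disjoint_union_left.2 ⟨hd.2, hBV⟩⟩
    rw [Finset.card_union_of_disjoint hd.1, hJm]
    omega
  · intro I hI
    simp only [Finset.coe_filter, Finset.mem_powersetCard, Set.mem_ofPred_eq] at hI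
    exact Finset.sdiff_union_of_subset hI.2.1
  · intro J hJ
    rw [Finset.mem_coe, Finset.mem_powersetCard] at hJ
    have hd : Disjoint J B := Finset.disjoint_left.2 fun i hi hiB =>
      Finset.mem_compl.1 (hJ.1 hi) (Finset.mem_union_left _ hiB)
    exact Finset.union_sdiff_cancel_right hd

/-- The `(p + 1)`-sets of indices with exactly `k` violators. -/
noncomputable def bases (X : Matrix (Fin n) (Fin p) ℝ) (y : Fin n → ℝ) (k : ℕ) :
    Finset (Finset (Fin n)) :=
  {B ∈ Finset.univ.powersetCard (p + 1) | (violators X y B).card = k}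

theorem mem_bases {k : ℕ} :
    B ∈ bases X y k ↔ B.card = p + 1 ∧ (violators X y B).card = k := by
  simp [bases, Finset.mem_powersetCard]

/-- Each `m`-set of indices has one base, and a base with `a` violators is the base of
`(q - a).choose j` of them, where `n = p + q + 1` and `m = p + j + 1`. -/
theorem Nondegenerate.sum_card_bases_mul_choose (h : Nondegenerate X y) {q j : ℕ}
    (hn : n = p + q + 1) :
    ∑ a ∈ Finset.range (q + 1), (bases X y a).card * (q - a).choose j =
      (p + q + 1).choose (p + j + 1) := by
  have hm : ∀ I ∈ (Finset.univ : Finset (Fin n)).powersetCard (p + j + 1), p + 1 ≤ I.card := by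
    intro I hI
    rw [(Finset.mem_powersetCard.1 hI).2]
    omega
  have hfib := Finset.card_eq_sum_card_fiberwise (f := base X y)
    (s := (Finset.univ : Finset (Fin n)).powersetCard (p + j + 1))
    (t := Finset.univ.powersetCard (p + 1)) fun I hI =>
      Finset.mem_powersetCard.2 ⟨Finset.subset_univ _, h.card_base (hm I hI)⟩
  have hterm : ∀ B ∈ (Finset.univ : Finset (Fin n)).powersetCard (p + 1),
      (((Finset.univ : Finset (Fin n)).powersetCard (p + j + 1)).filter
        fun I => base X y I = B).card = (q - (violators X y B).card).choose j := by
    intro B hB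
    have hB := (Finset.mem_powersetCard.1 hB).2
    rw [Finset.filter_congr fun I hI => h.base_eq_iff (hm I hI) hB,
      card_filter_subset_disjoint disjoint_violators (by omega), hB, Fintype.card_fin]
    congr 1 <;> omega
  rw [Finset.sum_congr rfl hterm, Finset.card_powersetCard, Finset.card_univ, Fintype.card_fin,
    ← Finset.sum_fiberwise_of_maps_to (t := Finset.range (q + 1))
      (g := fun B => (violators X y B).card)] at hfib
  · rw [← hn, hfib]
    refine Finset.sum_congr rfl fun a _ => ?_
    rw [Finset.sum_congr rfl fun B hB => by rw [(Finset.mem_filter.1 hB).2], Finset.sum_const,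
      smul_eq_mul]
    rfl
  · intro B hB
    have := card_violators_add_le (X := X) (y := y) (Finset.mem_powersetCard.1 hB).2
    rw [Finset.mem_range]
    omega

theorem Nondegenerate.card_bases (h : Nondegenerate X y) {k : ℕ} (hk : k + (p + 1) ≤ n) :
    (bases X y k).card = (p + k).choose p := by
  refine eq_of_sum_mul_choose_eq (q := n - (p + 1)) (u := fun a => (bases X y a).card)
    (v := fun a => (p + a).choose p) (fun j _ => ?_) k (by omega)
  rw [h.sum_card_bases_mul_choose (by omega), sum_choose_mul_choose]

/-! ### Local minima of the trimmed maximum -/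

theorem trimmedMax_le {k : ℕ} (hI : I.card = n - k) :
    trimmedMax X y k θ ≤ maxAbsResidual X y I θ :=
  ciInf_le (f := fun I : {I : Finset (Fin n) // I.card = n - k} => maxAbsResidual X y I.1 θ)
    (Set.finite_range _).bddBelow ⟨I, hI⟩

theorem exists_trimmedMax_eq (k : ℕ) (θ : Fin p → ℝ) :
    ∃ I : Finset (Fin n), I.card = n - k ∧ trimmedMax X y k θ = maxAbsResidual X y I θ := by
  obtain ⟨J, -, hJ⟩ := Finset.exists_subset_card_eq (s := (Finset.univ : Finset (Fin n)))
    (n := n - k) (by simp)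
  have : Nonempty {I : Finset (Fin n) // I.card = n - k} := ⟨⟨J, hJ⟩⟩
  obtain ⟨I, hI⟩ := exists_eq_ciInf_of_finite
    (f := fun I : {I : Finset (Fin n) // I.card = n - k} => maxAbsResidual X y I.1 θ)
  exact ⟨I.1, I.2, hI.symm⟩

/-- Near the Chebyshev fit to a base with `k` violators, an index set of size `n - k` either
avoids the violators, and then contains the base, or contains a violator, whose residual
is too large. -/
theorem Nondegenerate.eventually_le_trimmedMax (h : Nondegenerate X y) {k : ℕ}
    (hB : B ∈ bases X y k) :
    ∀ᶠ φ in nhds (fit X y B), maxAbsResidual X y B (fit X y B) ≤ trimmedMax X y k φ := by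
  obtain ⟨hB, hk⟩ := mem_bases.1 hB
  have hev : ∀ᶠ φ in nhds (fit X y B), ∀ i ∈ violators X y B,
      maxAbsResidual X y B (fit X y B) < |residual X y φ i| := by
    rw [Filter.eventually_all_finset]
    exact fun i hi => continuousAt_const.eventually_lt
      (continuous_residual (X := X) (y := y) i).abs.continuousAt (mem_violators.1 hi)
  filter_upwards [hev] with φ hφ
  obtain ⟨I, hI, he⟩ := exists_trimmedMax_eq (X := X) (y := y) k φ
  rw [he]
  by_cases hd : Disjoint I (violators X y B)
  · have hIV : I = (violators X y B)ᶜ := Finset.eq_of_subset_of_card_le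
      (fun i hi => Finset.mem_compl.2 (Finset.disjoint_left.1 hd hi))
      (by rw [Finset.card_compl, hk, hI, Fintype.card_fin])
    refine (h.isFit_fit hB.ge φ).trans (maxAbsResidual_mono fun i hi => ?_)
    rw [hIV]
    exact Finset.mem_compl.2 (Finset.disjoint_left.1 disjoint_violators hi)
  · obtain ⟨i, hi, hv⟩ := Finset.not_disjoint_iff.1 hd
    exact (hφ i hv).le.trans (abs_residual_le_maxAbsResidual hi)

theorem Nondegenerate.trimmedMax_fit (h : Nondegenerate X y) {k : ℕ} (hB : B ∈ bases X y k) :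
    trimmedMax X y k (fit X y B) = maxAbsResidual X y B (fit X y B) := by
  refine le_antisymm ?_ (h.eventually_le_trimmedMax hB).self_of_nhds
  obtain ⟨hB, hk⟩ := mem_bases.1 hB
  have hsub : B ⊆ (violators X y B)ᶜ := fun i hi =>
    Finset.mem_compl.2 (Finset.disjoint_left.1 disjoint_violators hi)
  rw [← (h.fit_eq_of_subset hB hsub disjoint_compl_left).2]
  exact trimmedMax_le (by rw [Finset.card_compl, hk, Fintype.card_fin])

theorem Nondegenerate.isLocalMin_trimmedMax_fit (h : Nondegenerate X y) {k : ℕ}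
    (hB : B ∈ bases X y k) : IsLocalMin (trimmedMax X y k) (fit X y B) := by
  filter_upwards [h.eventually_le_trimmedMax hB] with φ hφ
  rwa [h.trimmedMax_fit hB]

/-- If `θ` is a local minimum and `I` attains the trimmed maximum at `θ`, then `θ` is the
Chebyshev fit to `I`. The violators of the base of `I` are exactly the complement of `I`: a
further index outside `I` that is not a violator could be exchanged for a tight one, leaving a
base with fewer than `p + 1` elements. -/
theorem Nondegenerate.exists_fit_eq_of_isLocalMin (h : Nondegenerate X y) {k : ℕ}
    (hk : k + (p + 1) ≤ n) (hθ : IsLocalMin (trimmedMax X y k) θ) :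
    ∃ B ∈ bases X y k, fit X y B = θ := by
  obtain ⟨I, hI, he⟩ := exists_trimmedMax_eq (X := X) (y := y) k θ
  have hIc : p + 1 ≤ I.card := by omega
  have hfit : θ = fit X y I := h.eq_fit hIc <| IsFit.of_isLocalMin <| by
    filter_upwards [hθ] with φ hφ
    exact he ▸ hφ.trans (trimmedMax_le hI)
  have hB := h.card_base hIc
  obtain ⟨h1, h2⟩ := h.fit_base hIc
  refine ⟨base X y I, mem_bases.2 ⟨hB, ?_⟩, by rw [h1, hfit]⟩
  have hV : violators X y (base X y I) = Iᶜ := by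
    refine Finset.Subset.antisymm (fun i hi => Finset.mem_compl.2 fun hiI => ?_) fun i hi => ?_
    · exact Finset.disjoint_left.1 ((h.base_eq_iff hIc hB).1 rfl).2 hiI hi
    · rw [Finset.mem_compl] at hi
      rw [mem_violators, h1, h2, ← hfit]
      by_contra! hle
      have hne : |residual X y θ i| ≠ maxAbsResidual X y I θ := fun hc => by
        rw [hfit, ← h2, ← h1, h.abs_residual_fit_eq_iff hB] at hc
        exact hi (tight_subset hc)
      have hlt := lt_of_le_of_ne hle hne
      obtain ⟨b, hb⟩ : (base X y I).Nonempty := Finset.card_pos.1 (by omega)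
      have hbI := tight_subset hb
      have hJ : (insert i (I.erase b)).card = n - k := by
        rw [Finset.card_insert_of_notMem (fun hc => hi (Finset.mem_of_mem_erase hc)),
          Finset.card_erase_of_mem hbI]
        omega
      have hJle : maxAbsResidual X y (insert i (I.erase b)) θ ≤ trimmedMax X y k θ := by
        rw [he]
        refine maxAbsResidual_le maxAbsResidual_nonneg
          (Finset.forall_mem_insert _ _ _ |>.2 ⟨hle, fun j hj => ?_⟩)
        exact abs_residual_le_maxAbsResidual (Finset.mem_of_mem_erase hj)
      have hJe := le_antisymm hJle (trimmedMax_le hJ)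
      have hJfit : IsFit X y (insert i (I.erase b)) θ := IsFit.of_isLocalMin <| by
        filter_upwards [hθ] with φ hφ
        exact hJe ▸ hφ.trans (trimmedMax_le hJ)
      have hcard := h.card_tight (by omega) hJfit
      have hsub : tight X y (insert i (I.erase b)) θ ⊆ (base X y I).erase b := by
        intro j hj
        obtain ⟨hjJ, hjr⟩ := mem_tight.1 hj
        rw [hJe, he] at hjr
        rcases Finset.mem_insert.1 hjJ with rfl | hjI
        · exact absurd hjr hne
        · obtain ⟨hjb, hjI⟩ := Finset.mem_erase.1 hjI
          exact Finset.mem_erase.2 ⟨hjb, mem_tight.2 ⟨hjI, hfit ▸ hjr⟩⟩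
      have := Finset.card_le_card hsub
      rw [Finset.card_erase_of_mem hb] at this
      omega
  rw [hV, Finset.card_compl, hI, Fintype.card_fin]
  omega

theorem Nondegenerate.injOn_fit (h : Nondegenerate X y) (k : ℕ) :
    Set.InjOn (fit X y) (bases X y k : Set (Finset (Fin n))) := by
  intro B hB C hC hBC
  ext i
  rw [← h.abs_residual_fit_eq_iff (mem_bases.1 hB).1, ← h.abs_residual_fit_eq_iff
    (mem_bases.1 hC).1, ← h.trimmedMax_fit hB, ← h.trimmedMax_fit hC, hBC]

theorem Nondegenerate.encard_localMinima_trimmedMax (h : Nondegenerate X y) {k : ℕ}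
    (hk : k + (p + 1) ≤ n) :
    (localMinima (trimmedMax X y k)).encard = ((p + k).choose p : ℕ∞) := by
  have : localMinima (trimmedMax X y k) = fit X y '' (bases X y k : Set (Finset (Fin n))) := by
    ext θ
    refine ⟨fun hθ => h.exists_fit_eq_of_isLocalMin hk hθ, ?_⟩
    rintro ⟨B, hB, rfl⟩
    exact h.isLocalMin_trimmedMax_fit hB
  rw [this, (h.injOn_fit k).encard_image, Set.encard_coe_eq_coe_finsetCard, h.card_bases hk]

/-! ### Order statistics -/

theorem trimmedMax_eq_sorted {k : ℕ} (hk : k < n) (θ : Fin p → ℝ) :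
    trimmedMax X y k θ =
      sorted (fun i => |residual X y θ i|) ⟨n - k - 1, by omega⟩ := by
  set r : Fin n → ℝ := fun i => |residual X y θ i| with hr
  have hmono : Monotone (sorted r) := Tuple.monotone_sort r
  have hnonneg : ∀ j, 0 ≤ sorted r j := fun j => abs_nonneg _
  set m : Fin n := ⟨n - k - 1, by omega⟩ with hm
  apply le_antisymm
  · refine (trimmedMax_le (I := (Finset.Iic m).map (Tuple.sort r).toEmbedding) ?_).trans
      (maxAbsResidual_le (hnonneg m) ?_)
    · rw [Finset.card_map, Fin.card_Iic, hm]
      change n - k - 1 + 1 = n - k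
      omega
    · intro i hi
      obtain ⟨j, hj, rfl⟩ := Finset.mem_map.1 hi
      exact hmono (Finset.mem_Iic.1 hj)
  · obtain ⟨I, hI, he⟩ := exists_trimmedMax_eq (X := X) (y := y) k θ
    -- By cardinality `I` cannot consist of the `n - k - 1` smallest entries alone.
    obtain ⟨i, hi, him⟩ : ∃ i ∈ I, i ∉ (Finset.Iio m).map (Tuple.sort r).toEmbedding := by
      by_contra! hsub
      have := Finset.card_le_card hsub
      rw [Finset.card_map, Fin.card_Iio, hI, hm] at this
      change n - k ≤ n - k - 1 at this
      omega
    rw [he]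
    refine le_trans ?_ (abs_residual_le_maxAbsResidual hi)
    obtain ⟨j, rfl⟩ := (Tuple.sort r).surjective i
    have hmj : m ≤ j := not_lt.1 fun hlt => him <|
      Finset.mem_map_of_mem _ (Finset.mem_Iio.2 hlt)
    exact hmono hmj

/-- Squaring is monotone on absolute values, so it commutes with sorting them. -/
theorem med_sq {hn : 0 < n} (r : Fin n → ℝ) :
    med hn (fun i => r i ^ 2) = (med hn fun i => |r i|) ^ 2 := by
  have hmono : Monotone fun j => (sorted (fun i => |r i|) j) ^ 2 := fun i j hij =>
    pow_le_pow_left₀ (abs_nonneg _) (Tuple.monotone_sort (fun i => |r i|) hij) 2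
  have hperm : (fun i => r i ^ 2) ∘ Tuple.sort (fun i => |r i|) =
      fun j => (sorted (fun i => |r i|) j) ^ 2 := funext fun j => (sq_abs _).symm
  have := Tuple.unique_monotone (f := fun i => r i ^ 2) (σ := Tuple.sort fun i => r i ^ 2)
    (τ := Tuple.sort (fun i => |r i|)) (Tuple.monotone_sort _) (by rw [hperm]; exact hmono)
  exact congrFun (this.trans hperm) _

theorem med_abs_nonneg {hn : 0 < n} (r : Fin n → ℝ) : 0 ≤ med hn fun i => |r i| :=
  abs_nonneg _

theorem localMinima_sq {f : (Fin p → ℝ) → ℝ} (hf : ∀ θ, 0 ≤ f θ) :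
    localMinima (fun θ => f θ ^ 2) = localMinima f := by
  ext θ
  exact Filter.eventually_congr (Filter.Eventually.of_forall fun φ =>
    pow_le_pow_iff_left₀ (hf θ) (hf φ) two_ne_zero)

end LMS

theorem theorem1 {n p : ℕ} (X : Matrix (Fin n) (Fin p) ℝ) (y : Fin n → ℝ)
    (hXy : LMS.Nondegenerate X y) :
    (∀ (k : ℕ) (_hk : k + (p + 1) ≤ n),
      (∀ θ : Fin p → ℝ, LMS.trimmedMax X y k θ =
        LMS.sorted (fun i => |LMS.residual X y θ i|) ⟨n - k - 1, by omega⟩) ∧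
      (LMS.localMinima (LMS.trimmedMax X y k)).encard = ((p + k).choose p : ℕ∞)) ∧
    (∀ hn : 0 < n, 2 * p ≤ n →
      (LMS.localMinima (fun θ => LMS.med hn (fun i => |LMS.residual X y θ i|))).encard =
        ((p + (n - 1) / 2).choose p : ℕ∞) ∧
      (LMS.localMinima (fun θ => LMS.med hn (fun i => (LMS.residual X y θ i) ^ 2))).encard =
        ((p + (n - 1) / 2).choose p : ℕ∞)) := by
  -- `n - (n - 1) / 2 - 1 = n / 2`, so the median is the case `k = (n - 1) / 2`.
  refine ⟨fun k hk => ⟨LMS.trimmedMax_eq_sorted (by omega),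
    hXy.encard_localMinima_trimmedMax hk⟩, fun hn hp => ?_⟩
  have hmed : (fun θ => LMS.med hn fun i => |LMS.residual X y θ i|) =
      LMS.trimmedMax X y ((n - 1) / 2) := by
    funext θ
    rw [LMS.trimmedMax_eq_sorted (by omega), LMS.med]
    congr 2
    omega
  have habs : (LMS.localMinima fun θ => LMS.med hn fun i => |LMS.residual X y θ i|).encard =
      ((p + (n - 1) / 2).choose p : ℕ∞) := by
    rw [hmed]
    exact hXy.encard_localMinima_trimmedMax (by omega)
  refine ⟨habs, ?_⟩
  simp_rw [LMS.med_sq]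
  rwa [LMS.localMinima_sq fun θ => LMS.med_abs_nonneg _]
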